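/- Let $d\ge 1$ and let $\widehat D=\{r\in\mathbb R^d : r_i\ge -1 \text{ for all } i,\ \sum_i(1+r_i)\le 2\}$ be the reference simplex, with barycentric coordinates $l_i=(1+r_i)/2$ for $1\le i\le d$ and $l_0=1-\sum_{i=1}^d l_i$. Let $P^N$ be the space of polynomials of total degree at most $N$ in $r$. For $\alpha\in\mathbb N^{d+1}$ with $|\alpha|=N$ let $B^N_\alpha=\frac{N!}{\alpha_0!\cdots\alpha_d!}\,l_0^{\alpha_0}\cdots l_d^{\alpha_d}$ be the Bernstein polynomials; they form a basis of $P^N$. For $0\le i\le N$ let $E^N_{N-i}$ be the degree elevation matrix, i.e. the matrix of the inclusion $P^{N-i}\subset P^N$ in the Bernstein bases of degrees $N-i$ and $N$. Let $(M_N)_{\alpha\beta}=\int_{\widehat D}B^N_\alpha B^N_\beta$ be the Bernstein mass matrix. Let $(L_\gamma)_{\gamma\in\mathbb N^d}$ be any hierarchical orthogonal (modal) basis: for every $N$ the $L_\gamma$ with $|\gamma|\le N$ form a basis of $P^N$, and $\int_{\widehat D}L_\nu L_\gamma=0$ for $\nu\ne\gamma$. Let $T_N$ be the invertible matrix that turns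 modal coefficients into Bernstein coefficients, so that $\sum_{|\gamma|\le N}c_\gamma L_\gamma=\sum_{|\alpha|=N}(T_Nc)_\alpha B^N_\alpha$ for all $c$. Then each $M_n$ ($n\ge 0$) has exactly $n+1$ distinct eigenvalues, all positive; denote them by $\lambda^n_0>\lambda^n_1>\dots>\lambda^n_n$. Moreover, for all $0\le i\le N$, the matrix $T_N^{-1}E^N_{N-i}(E^N_{N-i})^TT_N$ is diagonal, with entries $$\left(T_N^{-1}E^N_{N-i}(E^N_{N-i})^TT_N\right)_{\gamma\gamma}=\begin{cases}0,&|\gamma|>N-i,\\ \lambda^{N-i}_{|\gamma|}/\lambda^N_{|\gamma|},&|\gamma|\le N-i,\end{cases}\qquad |\gamma|\le N.$$ -/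

import Mathlib

open MeasureTheory Module
open scoped Nat Matrix

namespace BernsteinSimplex

noncomputable section

/-- The bi-unit right simplex in `ℝ^d`: all coordinates are at least `-1` and
`∑ (1 + r_i) ≤ 2`.  For `d = 3` this is `r, s, t ≥ -1`, `r + s + t ≤ -1`. -/
def refSimplex (d : ℕ) : Set (Fin d → ℝ) :=
  {r | (∀ i, -1 ≤ r i) ∧ ∑ i, (1 + r i) ≤ 2}

/-- Barycentric coordinates of the reference simplex as polynomials in `r`:
`l_{i+1} = (1 + r_i) / 2` and `l_0 = 1 - ∑ (1 + r_i) / 2`. -/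
def bary (d : ℕ) : Fin (d + 1) → MvPolynomial (Fin d) ℝ :=
  Fin.cons (1 - ∑ i, MvPolynomial.C (1 / 2) * (1 + MvPolynomial.X i))
    (fun i => MvPolynomial.C (1 / 2) * (1 + MvPolynomial.X i))

/-- Multi-indices `α = (α_0, …, α_d)` with `|α| = N`. -/
abbrev BernsteinIndex (d N : ℕ) : Type := {α : Fin (d + 1) → ℕ // ∑ j, α j = N}

/-- Multi-indices `γ = (γ_1, …, γ_d)` with `|γ| ≤ N`. -/
abbrev ModalIndex (d N : ℕ) : Type := {γ : Fin d → ℕ // ∑ j, γ j ≤ N}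

/-- Bernstein indices of degree `N` correspond to modal indices of degree at most `N`
by forgetting `α_0`. -/
def indexEquiv (d N : ℕ) : BernsteinIndex d N ≃ ModalIndex d N where
  toFun α := ⟨fun i => α.1 i.succ, by
    have h := α.2
    rw [Fin.sum_univ_succ] at h
    exact (Nat.le_add_left _ _).trans h.le⟩
  invFun γ := ⟨Fin.cons (N - ∑ j, γ.1 j) γ.1, by
    have h := γ.2
    rw [Fin.sum_univ_succ]
    simp only [Fin.cons_zero, Fin.cons_succ]
    omega⟩
  left_inv α := by
    have h := α.2
    rw [Fin.sum_univ_succ] at h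
    ext j
    refine Fin.cases ?_ (fun i => ?_) j
    · simp only [Fin.cons_zero]
      omega
    · simp only [Fin.cons_succ]
  right_inv γ := by
    ext j
    simp only [Fin.cons_succ]

/-- Modal indices of degree at most `N`, as finitely supported functions. -/
def modalIndexEquivFinsupp (d N : ℕ) :
    ModalIndex d N ≃ {n : Fin d →₀ ℕ | n.degree ≤ N} :=
  (Finsupp.equivFunOnFinite : (Fin d →₀ ℕ) ≃ (Fin d → ℕ)).symm.subtypeEquiv (fun γ => by
    simp [Finsupp.degree_eq_sum])

instance (d N : ℕ) : Finite (ModalIndex d N) := by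
  refine Set.Finite.subset
    (Set.Finite.pi' (t := fun _ : Fin d => Set.Iic N) fun _ => Set.finite_Iic N) ?_
  intro γ hγ i
  exact (Finset.single_le_sum (f := γ) (fun _ _ => Nat.zero_le _) (Finset.mem_univ i)).trans hγ

instance (d N : ℕ) : Fintype (ModalIndex d N) := Fintype.ofFinite _

instance (d N : ℕ) : Fintype (BernsteinIndex d N) := Fintype.ofEquiv _ (indexEquiv d N).symm

/-- The space `P^N` of polynomials in `d` variables of total degree at most `N`. -/
abbrev polySpace (d N : ℕ) : Submodule ℝ (MvPolynomial (Fin d) ℝ) :=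
  MvPolynomial.restrictTotalDegree (Fin d) ℝ N

/-- The Bernstein polynomial `B^N_α = N! / (α_0! ⋯ α_d!) * l_0^{α_0} ⋯ l_d^{α_d}`. -/
def bernstein (d N : ℕ) (α : BernsteinIndex d N) : MvPolynomial (Fin d) ℝ :=
  MvPolynomial.C ((N ! : ℝ) / ∏ j, ((α.1 j)! : ℝ)) * ∏ j, bary d j ^ α.1 j

/-! ### The Bernstein polynomials of degree `N` form a basis of `P^N` -/

theorem sum_bary (d : ℕ) : ∑ j, bary d j = 1 := by
  rw [Fin.sum_univ_succ]
  simp [bary]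

theorem totalDegree_bary_le (d : ℕ) (j : Fin (d + 1)) : (bary d j).totalDegree ≤ 1 := by
  have key : ∀ i : Fin d, (MvPolynomial.C (1 / 2 : ℝ) *
      (1 + MvPolynomial.X i) : MvPolynomial (Fin d) ℝ).totalDegree ≤ 1 := by
    intro i
    refine (MvPolynomial.totalDegree_mul _ _).trans ?_
    have h := MvPolynomial.totalDegree_add (1 : MvPolynomial (Fin d) ℝ) (MvPolynomial.X i)
    rw [MvPolynomial.totalDegree_one, MvPolynomial.totalDegree_X] at h
    rw [MvPolynomial.totalDegree_C]
    simpa using h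
  refine Fin.cases ?_ (fun i => ?_) j
  · simp only [bary, Fin.cons_zero]
    refine (MvPolynomial.totalDegree_sub _ _).trans (max_le (by simp) ?_)
    exact MvPolynomial.totalDegree_finsetSum_le fun i _ => key i
  · simpa only [bary, Fin.cons_succ] using key i

theorem bernstein_mem (d N : ℕ) (α : BernsteinIndex d N) : bernstein d N α ∈ polySpace d N := by
  rw [MvPolynomial.mem_restrictTotalDegree, bernstein]
  refine (MvPolynomial.totalDegree_mul _ _).trans ?_
  rw [MvPolynomial.totalDegree_C, zero_add]
  refine (MvPolynomial.totalDegree_finsetProd _ _).trans ?_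
  refine (Finset.sum_le_sum (g := α.1) fun j _ => ?_).trans α.2.le
  refine (MvPolynomial.totalDegree_pow _ _).trans ?_
  simpa using Nat.mul_le_mul_left (α.1 j) (totalDegree_bary_le d j)

/-- The index `α + e_j`. -/
def BernsteinIndex.incr {d n : ℕ} (α : BernsteinIndex d n) (j : Fin (d + 1)) :
    BernsteinIndex d (n + 1) :=
  ⟨α.1 + Pi.single j 1, by simp [Finset.sum_add_distrib, α.2]⟩

theorem bary_mul_bernstein {d n : ℕ} (α : BernsteinIndex d n) (j : Fin (d + 1)) :
    bary d j * bernstein d n α =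
      (((α.1 j : ℝ) + 1) / (n + 1)) • bernstein d (n + 1) (α.incr j) := by
  have h1 : ∏ k, bary d k ^ (α.1 + Pi.single j 1 : Fin (d + 1) → ℕ) k = bary d j * ∏ k, bary d k ^ α.1 k := by
    simp only [Pi.add_apply, pow_add, Finset.prod_mul_distrib]
    rw [mul_comm]
    congr 1
    rw [Finset.prod_eq_single j] <;> simp +contextual
  have h2 : ∏ k, (((α.1 + Pi.single j 1 : Fin (d + 1) → ℕ) k)! : ℝ) = (α.1 j + 1) * ∏ k, ((α.1 k)! : ℝ) := by
    rw [← Finset.mul_prod_erase _ _ (Finset.mem_univ j),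
      ← Finset.mul_prod_erase Finset.univ (fun k => ((α.1 k)! : ℝ)) (Finset.mem_univ j),
      ← mul_assoc]
    congr 1
    · simp [Nat.factorial_succ]
    · refine Finset.prod_congr rfl fun k hk => ?_
      simp [Pi.single_eq_of_ne (Finset.ne_of_mem_erase hk)]
  have h3 : ∏ k, ((α.1 k)! : ℝ) ≠ 0 :=
    Finset.prod_ne_zero_iff.mpr fun k _ => Nat.cast_ne_zero.mpr (Nat.factorial_ne_zero _)
  have h4 : (α.1 j + 1 : ℝ) ≠ 0 := by positivity
  have h5 : (n + 1 : ℝ) ≠ 0 := by positivity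
  rw [bernstein, bernstein, BernsteinIndex.incr]
  simp only []
  rw [h1, h2, MvPolynomial.smul_eq_C_mul, ← mul_assoc (MvPolynomial.C _) (MvPolynomial.C _),
    ← MvPolynomial.C_mul, mul_left_comm]
  congr 2
  rw [Nat.factorial_succ]
  push_cast
  field_simp

theorem bary_mul_mem_span {d n : ℕ} (j : Fin (d + 1)) {p : MvPolynomial (Fin d) ℝ}
    (hp : p ∈ Submodule.span ℝ (Set.range (bernstein d n))) :
    bary d j * p ∈ Submodule.span ℝ (Set.range (bernstein d (n + 1))) := by
  induction hp using Submodule.span_induction with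
  | mem x hx =>
    obtain ⟨α, rfl⟩ := hx
    rw [bary_mul_bernstein]
    exact Submodule.smul_mem _ _ (Submodule.subset_span ⟨_, rfl⟩)
  | zero => simp
  | add x y _ _ hx hy => rw [mul_add]; exact Submodule.add_mem _ hx hy
  | smul a x _ hx => rw [mul_smul_comm]; exact Submodule.smul_mem _ _ hx

theorem mem_span_succ {d n : ℕ} {p : MvPolynomial (Fin d) ℝ}
    (hp : p ∈ Submodule.span ℝ (Set.range (bernstein d n))) :
    p ∈ Submodule.span ℝ (Set.range (bernstein d (n + 1))) := by
  rw [← one_mul p, ← sum_bary d, Finset.sum_mul]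
  exact Submodule.sum_mem _ fun j _ => bary_mul_mem_span j hp

theorem X_mul_mem_span {d n : ℕ} (i : Fin d) {p : MvPolynomial (Fin d) ℝ}
    (hp : p ∈ Submodule.span ℝ (Set.range (bernstein d n))) :
    MvPolynomial.X i * p ∈ Submodule.span ℝ (Set.range (bernstein d (n + 1))) := by
  have h : MvPolynomial.X i * p = (2 : ℝ) • (bary d i.succ * p) - p := by
    have h2 : (MvPolynomial.C (2 : ℝ) * MvPolynomial.C (1 / 2) : MvPolynomial (Fin d) ℝ) = 1 := by
      rw [← MvPolynomial.C_mul]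
      norm_num
    rw [MvPolynomial.smul_eq_C_mul]
    simp only [bary, Fin.cons_succ]
    linear_combination (-(1 + MvPolynomial.X i) * p) * h2
  rw [h]
  exact Submodule.sub_mem _ (Submodule.smul_mem _ _ (bary_mul_mem_span _ hp)) (mem_span_succ hp)

theorem monomial_mem_span (d n : ℕ) : ∀ γ : Fin d →₀ ℕ, γ.degree ≤ n →
    MvPolynomial.monomial γ (1 : ℝ) ∈ Submodule.span ℝ (Set.range (bernstein d n)) := by
  induction n with
  | zero =>
    intro γ hγ
    have h0 : γ = 0 := (Finsupp.degree_eq_zero_iff γ).mp (Nat.le_zero.mp hγ)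
    subst h0
    refine Submodule.subset_span ⟨⟨0, by simp⟩, ?_⟩
    simp [bernstein]
  | succ n ih =>
    intro γ hγ
    by_cases h0 : γ = 0
    · subst h0
      exact mem_span_succ (ih 0 (by simp))
    · obtain ⟨i, hi⟩ := Finsupp.ne_iff.mp h0
      have hle : Finsupp.single i 1 ≤ γ := by
        rw [Finsupp.single_le_iff]
        exact Nat.one_le_iff_ne_zero.mpr hi
      have hγ' : γ = Finsupp.single i 1 + (γ - Finsupp.single i 1) :=
        (add_tsub_cancel_of_le hle).symm
      have hdeg : (γ - Finsupp.single i 1).degree ≤ n := by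
        have := congrArg Finsupp.degree hγ'
        rw [map_add, Finsupp.degree_single] at this
        omega
      have hX : MvPolynomial.monomial γ (1 : ℝ) =
          MvPolynomial.X i * MvPolynomial.monomial (γ - Finsupp.single i 1) 1 := by
        rw [MvPolynomial.X, MvPolynomial.monomial_mul, one_mul, ← hγ']
      rw [hX]
      exact X_mul_mem_span i (ih _ hdeg)

theorem polySpace_le_span (d N : ℕ) :
    polySpace d N ≤ Submodule.span ℝ (Set.range (bernstein d N)) := by
  rw [polySpace, MvPolynomial.restrictTotalDegree, MvPolynomial.restrictSupport_eq_span,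
    Submodule.span_le]
  rintro _ ⟨γ, hγ, rfl⟩
  exact monomial_mem_span d N γ hγ

theorem card_bernsteinIndex (d N : ℕ) :
    Fintype.card (BernsteinIndex d N) = finrank ℝ (polySpace d N) := by
  have b : Basis {n : Fin d →₀ ℕ | n.degree ≤ N} ℝ (polySpace d N) :=
    MvPolynomial.basisRestrictSupport ℝ _
  rw [finrank_eq_nat_card_basis b, ← Nat.card_congr (modalIndexEquivFinsupp d N), ← Nat.card_congr (indexEquiv d N),
    Nat.card_eq_fintype_card]

/-- The Bernstein polynomials of degree `N`, as a basis of `P^N`. -/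
def bernsteinBasis (d N : ℕ) : Basis (BernsteinIndex d N) ℝ (polySpace d N) :=
  basisOfTopLeSpanOfCardEqFinrank
    (fun α => (⟨bernstein d N α, bernstein_mem d N α⟩ : polySpace d N))
    (by
      rintro ⟨p, hp⟩ -
      have h := polySpace_le_span d N hp
      have hmap : Submodule.map (polySpace d N).subtype (Submodule.span ℝ (Set.range
          fun α => (⟨bernstein d N α, bernstein_mem d N α⟩ : polySpace d N))) =
          Submodule.span ℝ (Set.range (bernstein d N)) := by
        rw [Submodule.map_span, ← Set.range_comp]
        rfl
      rw [← hmap] at h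
      obtain ⟨q, hq, hqp⟩ := h
      have hq' : q = ⟨p, hp⟩ := Subtype.ext hqp
      exact hq' ▸ hq)
    (card_bernsteinIndex d N)

@[simp]
theorem coe_bernsteinBasis (d N : ℕ) (α : BernsteinIndex d N) :
    (bernsteinBasis d N α : MvPolynomial (Fin d) ℝ) = bernstein d N α := by
  simp [bernsteinBasis]

/-! ### Degree elevation, mass matrix and its distinct eigenvalues -/

theorem polySpace_mono (d : ℕ) {n N : ℕ} (h : n ≤ N) : polySpace d n ≤ polySpace d N := by
  intro p hp
  rw [MvPolynomial.mem_restrictTotalDegree] at hp ⊢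
  exact hp.trans h

/-- The degree elevation matrix `E_n^N`: the matrix, in the Bernstein bases of degrees `n` and `N`,
of the inclusion of `P^n` into `P^N`. -/
def elevation (d : ℕ) {n N : ℕ} (h : n ≤ N) :
    Matrix (BernsteinIndex d N) (BernsteinIndex d n) ℝ :=
  LinearMap.toMatrix (bernsteinBasis d n) (bernsteinBasis d N)
    (Submodule.inclusion (polySpace_mono d h))

/-- The `L²` inner product of two polynomials over the reference simplex. -/
def simplexInner (d : ℕ) (p q : MvPolynomial (Fin d) ℝ) : ℝ :=
  ∫ r in refSimplex d, MvPolynomial.eval r p * MvPolynomial.eval r q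

/-- The Bernstein mass matrix `M_N`. -/
def massMatrix (d N : ℕ) : Matrix (BernsteinIndex d N) (BernsteinIndex d N) ℝ :=
  Matrix.of fun α β => simplexInner d (bernstein d N β) (bernstein d N α)

/-- The `k`-th distinct eigenvalue of the Bernstein mass matrix `M_N`, for `k = 0, 1, …`, where the
distinct eigenvalues are listed in decreasing order (and `0` if there is no `k`-th one). -/
def massEigenvalue (d N k : ℕ) : ℝ :=
  ((massMatrix d N).finite_spectrum.toFinset.sort (· ≥ ·)).getD k 0

/-! ### Modal bases -/

/-- A hierarchical orthogonal (modal) basis on the reference simplex: for every `N` the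
polynomials `L_γ` with `|γ| ≤ N` form a basis of `P^N`, and distinct ones are orthogonal. -/
structure IsModalBasis (d : ℕ) (L : (Fin d → ℕ) → MvPolynomial (Fin d) ℝ) : Prop where
  linearIndependent : LinearIndependent ℝ L
  span_eq : ∀ N, Submodule.span ℝ (L '' {γ | ∑ j, γ j ≤ N}) = polySpace d N
  orthogonal : ∀ ν γ, ν ≠ γ → simplexInner d (L ν) (L γ) = 0

theorem IsModalBasis.span_range_eq {d : ℕ} {L : (Fin d → ℕ) → MvPolynomial (Fin d) ℝ}
    (hL : IsModalBasis d L) (N : ℕ) :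
    Submodule.span ℝ (Set.range fun γ : ModalIndex d N => L γ.1) = polySpace d N := by
  rw [← hL.span_eq N, Set.image_eq_range]
  rfl

/-- The modal polynomials `L_γ` with `|γ| ≤ N`, as a basis of `P^N`. -/
def IsModalBasis.basis {d : ℕ} {L : (Fin d → ℕ) → MvPolynomial (Fin d) ℝ}
    (hL : IsModalBasis d L) (N : ℕ) : Basis (ModalIndex d N) ℝ (polySpace d N) :=
  (Basis.span (hL.linearIndependent.comp (fun γ : ModalIndex d N => γ.1)
    Subtype.val_injective)).map (LinearEquiv.ofEq _ _ (hL.span_range_eq N))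

@[simp]
theorem IsModalBasis.coe_basis {d : ℕ} {L : (Fin d → ℕ) → MvPolynomial (Fin d) ℝ}
    (hL : IsModalBasis d L) (N : ℕ) (γ : ModalIndex d N) :
    (hL.basis N γ : MvPolynomial (Fin d) ℝ) = L γ.1 := by
  simp [IsModalBasis.basis, Basis.span_apply]

/-- The transformation matrix `T_N` from modal to Bernstein coefficients: column `γ` holds the
Bernstein coefficients of `L_γ`, so `c^B = T_N c^L`. -/
def IsModalBasis.transform {d : ℕ} {L : (Fin d → ℕ) → MvPolynomial (Fin d) ℝ}
    (hL : IsModalBasis d L) (N : ℕ) : Matrix (BernsteinIndex d N) (ModalIndex d N) ℝ :=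
  (bernsteinBasis d N).toMatrix (hL.basis N)

/-- The inverse `T_N⁻¹` of the transformation matrix, from Bernstein to modal coefficients. -/
def IsModalBasis.transformInv {d : ℕ} {L : (Fin d → ℕ) → MvPolynomial (Fin d) ℝ}
    (hL : IsModalBasis d L) (N : ℕ) : Matrix (ModalIndex d N) (BernsteinIndex d N) ℝ :=
  (hL.basis N).toMatrix (bernsteinBasis d N)

theorem IsModalBasis.transform_mul_transformInv {d : ℕ}
    {L : (Fin d → ℕ) → MvPolynomial (Fin d) ℝ} (hL : IsModalBasis d L) (N : ℕ) :
    hL.transform N * hL.transformInv N = 1 :=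
  Basis.toMatrix_mul_toMatrix_flip _ _

theorem IsModalBasis.transformInv_mul_transform {d : ℕ}
    {L : (Fin d → ℕ) → MvPolynomial (Fin d) ℝ} (hL : IsModalBasis d L) (N : ℕ) :
    hL.transformInv N * hL.transform N = 1 :=
  Basis.toMatrix_mul_toMatrix_flip _ _

end

end BernsteinSimplex

namespace BernsteinSimplex

noncomputable section

/-! ### Integration of polynomials over the reference simplex -/

/-! In the Bernstein basis, `massMatrix d N` represents the Bernstein–Durrmeyer operator D_N p = ∑_α
⟨p, B^N_α⟩ B^N_α, which is self-adjoint for the L² inner product. Two facts about D_N carry the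
proof.

Triangularity: by the Dirichlet integral, ⟨l^a, B^N_α⟩ is a constant times ∏_j (α_j + a_j)!/α_j!.
Vandermonde rewrites each factor in the binomials C(α_j, b_j) with b_j ≤ a_j, and the
factorial-moment identity sums these against B^N_α to multiples of l^b. Hence D_N preserves every
P^k and acts on P^k/P^{k-1} as the scalar λ_k = `durrmeyerEigenvalue d N k` (`durrmeyer_sub_mem`).
With self-adjointness, every p in P^k orthogonal to P^{k-1} is an eigenvector (`durrmeyer_eq_smul`),
in particular L_γ with k = |γ|. The λ_k are positive and strictly decreasing for k ≤ N, so they are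
the ordered spectrum.

Matrix algebra: write Λ_N for the diagonal matrix of eigenvalues, G for that of the squared norms of
the L_γ, J for the 0-1 inclusion of modal indices, and n = N - i. Then M_N T_N = T_N Λ_N and T_Nᵀ
M_N T_N = G give T_Nᵀ T_N = G Λ_N⁻¹. Transposing E T_n = T_N J then yields Eᵀ T_N = T_n Λ_n Jᵀ
Λ_N⁻¹, because the norms in G do not depend on the degree. So T_N⁻¹ E Eᵀ T_N = J Λ_n Jᵀ Λ_N⁻¹, which
is the claimed diagonal matrix. -/

theorem isClosed_refSimplex (d : ℕ) : IsClosed (refSimplex d) := by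
  rw [refSimplex, Set.ofPred_and, Set.ofPred_forall]
  refine (isClosed_iInter fun i => isClosed_le (by fun_prop) (by fun_prop)).inter
    (isClosed_le (by fun_prop) (by fun_prop))

theorem isCompact_refSimplex (d : ℕ) : IsCompact (refSimplex d) := by
  refine (isCompact_univ_pi fun _ : Fin d => isCompact_Icc (a := (-1 : ℝ)) (b := 1)).of_isClosed_subset
    (isClosed_refSimplex d) fun r hr i _ => ⟨hr.1 i, ?_⟩
  have h := Finset.single_le_sum (f := fun i => 1 + r i)
    (fun k _ => by linarith [hr.1 k]) (Finset.mem_univ i)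
  have h2 := hr.2
  linarith

theorem measurableSet_refSimplex (d : ℕ) : MeasurableSet (refSimplex d) :=
  (isClosed_refSimplex d).measurableSet

theorem integrableOn_eval (d : ℕ) (p : MvPolynomial (Fin d) ℝ) :
    IntegrableOn (fun r => MvPolynomial.eval r p) (refSimplex d) :=
  (MvPolynomial.continuous_eval p).continuousOn.integrableOn_compact (isCompact_refSimplex d)

/-- Integration over the reference simplex, as a linear functional on polynomials. -/
def simplexIntegral (d : ℕ) : MvPolynomial (Fin d) ℝ →ₗ[ℝ] ℝ where
  toFun p := ∫ r in refSimplex d, MvPolynomial.eval r p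
  map_add' p q := by
    rw [← integral_add (integrableOn_eval d p) (integrableOn_eval d q)]
    exact integral_congr_ae (Filter.Eventually.of_forall fun r => map_add _ p q)
  map_smul' c p := by
    rw [RingHom.id_apply, smul_eq_mul, ← integral_const_mul]
    exact integral_congr_ae (Filter.Eventually.of_forall fun r => MvPolynomial.smul_eval r p c)

theorem simplexInner_eq (d : ℕ) (p q : MvPolynomial (Fin d) ℝ) :
    simplexInner d p q = simplexIntegral d (p * q) := by
  simp [simplexInner, simplexIntegral]

theorem simplexInner_comm (d : ℕ) (p q : MvPolynomial (Fin d) ℝ) :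
    simplexInner d p q = simplexInner d q p := by
  rw [simplexInner_eq, simplexInner_eq, mul_comm]

/-- The continuous function p² ≥ 0 has integral zero, so it vanishes on an open cube inside the
simplex; a polynomial vanishing on a product of infinite sets is zero. -/
theorem eq_zero_of_simplexInner_self {d : ℕ} {p : MvPolynomial (Fin d) ℝ}
    (hp : simplexInner d p p = 0) : p = 0 := by
  -- With side 2/(d+1), the d shifted coordinates sum to at most 2; the d+1 also keeps the quotient
  -- meaningful for d = 0.
  set s : Set ℝ := Set.Ioo (-1) (-1 + 2 / (d + 1)) with hs
  have hs0 : (0 : ℝ) < 2 / (d + 1) := by positivity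
  have hU : IsOpen (Set.univ.pi fun _ : Fin d => s) :=
    isOpen_set_pi Set.finite_univ fun _ _ => isOpen_Ioo
  have hsub : (Set.univ.pi fun _ : Fin d => s) ⊆ refSimplex d := by
    intro r hr
    refine ⟨fun i => (hr i trivial).1.le, ?_⟩
    calc ∑ i, (1 + r i) ≤ ∑ _i : Fin d, (2 / (d + 1) : ℝ) :=
          Finset.sum_le_sum fun i _ => by linarith [(hr i trivial).2]
      _ = d * (2 / (d + 1)) := by simp
      _ ≤ 2 := by
        rw [mul_div_assoc', div_le_iff₀ (by positivity)]
        linarith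
  have hint : IntegrableOn (fun r => MvPolynomial.eval r p * MvPolynomial.eval r p)
      (refSimplex d) := by
    simpa using integrableOn_eval d (p * p)
  have h0 := (setIntegral_eq_zero_iff_of_nonneg_ae
    (Filter.Eventually.of_forall fun r => mul_self_nonneg _) hint).mp hp
  have h1 := Measure.eqOn_open_of_ae_eq (ae_restrict_of_ae_restrict_of_subset hsub h0) hU
    ((MvPolynomial.continuous_eval p).mul (MvPolynomial.continuous_eval p)).continuousOn
    continuousOn_const
  refine MvPolynomial.funext_set (fun _ : Fin d => s)
    (fun _ => Set.Ioo_infinite (by linarith)) fun r hr => ?_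
  simpa using h1 hr

theorem simplexIntegral_one_pos (d : ℕ) : 0 < simplexIntegral d 1 := by
  refine lt_of_le_of_ne ?_ fun h => one_ne_zero (α := MvPolynomial (Fin d) ℝ) ?_
  · simp [simplexIntegral]
  · exact eq_zero_of_simplexInner_self (by rw [simplexInner_eq, mul_one, ← h])

theorem hasDerivAt_eval_insertNth {n : ℕ} (j : Fin (n + 1)) (y : Fin n → ℝ)
    (p : MvPolynomial (Fin (n + 1)) ℝ) (t : ℝ) :
    HasDerivAt (fun t => MvPolynomial.eval (j.insertNth t y : Fin (n + 1) → ℝ) p)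
      (MvPolynomial.eval (j.insertNth t y : Fin (n + 1) → ℝ) (MvPolynomial.pderiv j p)) t := by
  induction p using MvPolynomial.induction_on with
  | C a => simpa using hasDerivAt_const t a
  | add p q hp hq =>
    simp only [map_add]
    exact hp.add hq
  | mul_X p i hp =>
    have hX : HasDerivAt (fun t => (j.insertNth t y : Fin (n + 1) → ℝ) i)
        (MvPolynomial.eval (j.insertNth t y : Fin (n + 1) → ℝ)
          (MvPolynomial.pderiv j (MvPolynomial.X i))) t := by
      rcases Fin.eq_self_or_eq_succAbove j i with rfl | ⟨k, rfl⟩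
      · simpa using hasDerivAt_id' t
      · simpa [MvPolynomial.pderiv_X_of_ne (Fin.succAbove_ne j k)] using hasDerivAt_const t (y k)
    have h := hp.mul hX
    simp only [map_mul, MvPolynomial.eval_X, Derivation.leibniz, smul_eq_mul, map_add]
    exact h.congr_deriv (by ring)

theorem insertNth_mem_refSimplex {n : ℕ} (j : Fin (n + 1)) (y : Fin n → ℝ) (t : ℝ) :
    (j.insertNth t y : Fin (n + 1) → ℝ) ∈ refSimplex (n + 1) ↔
      (∀ i, -1 ≤ y i) ∧ t ∈ Set.Icc (-1) (1 - ∑ i, (1 + y i)) := by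
  rw [refSimplex, Set.mem_ofPred_eq, Fin.forall_iff_succAbove j, Fin.sum_univ_succAbove _ j]
  simp only [Fin.insertNth_apply_same, Fin.insertNth_apply_succAbove, Set.mem_Icc]
  constructor
  · rintro ⟨⟨h1, h2⟩, h3⟩
    exact ⟨h2, h1, by linarith⟩
  · rintro ⟨h1, h2, h3⟩
    exact ⟨⟨h2, h1⟩, by linarith⟩

/-- A partial derivative `∂p/∂r_j` integrates to zero over the simplex if `p` vanishes on the two
faces that are not parallel to the `r_j`-axis. -/
theorem simplexIntegral_pderiv {d : ℕ} (j : Fin d) (p : MvPolynomial (Fin d) ℝ)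
    (h1 : ∀ r : Fin d → ℝ, r j = -1 → MvPolynomial.eval r p = 0)
    (h2 : ∀ r : Fin d → ℝ, ∑ i, (1 + r i) = 2 → MvPolynomial.eval r p = 0) :
    simplexIntegral d (MvPolynomial.pderiv j p) = 0 := by
  obtain _ | n := d
  · exact j.elim0
  set f : (Fin (n + 1) → ℝ) → ℝ := (refSimplex (n + 1)).indicator
    fun r => MvPolynomial.eval r (MvPolynomial.pderiv j p) with hf
  have hfint : Integrable f :=
    (integrable_indicator_iff (measurableSet_refSimplex _)).mpr (integrableOn_eval _ _)
  have hmp := (volume_preserving_piFinSuccAbove (fun _ : Fin (n + 1) => ℝ) j).symm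
  have hint : Integrable (f ∘ (MeasurableEquiv.piFinSuccAbove (fun _ => ℝ) j).symm)
      (volume.prod volume) :=
    (hmp.integrable_comp_emb (MeasurableEquiv.measurableEmbedding _)).mpr hfint
  have hstep : simplexIntegral (n + 1) (MvPolynomial.pderiv j p) = ∫ r, f r :=
    (integral_indicator (measurableSet_refSimplex _)).symm
  rw [hstep, ← hmp.integral_comp (MeasurableEquiv.measurableEmbedding _)]
  -- Fubini with r_j innermost: each nonempty slice is an interval whose endpoints lie on the two
  -- faces where p vanishes, so the fundamental theorem of calculus gives 0.
  refine (integral_prod_symm _ hint).trans ?_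
  refine integral_eq_zero_of_ae (Filter.Eventually.of_forall fun y => ?_)
  simp only [Function.comp_apply, Pi.zero_apply]
  set b : ℝ := 1 - ∑ i, (1 + y i) with hb
  have hfy : ∀ t : ℝ, f ((MeasurableEquiv.piFinSuccAbove (fun _ => ℝ) j).symm (t, y)) =
      if ∀ i, -1 ≤ y i then (Set.Icc (-1) b).indicator (fun t => MvPolynomial.eval
        (j.insertNth t y : Fin (n + 1) → ℝ) (MvPolynomial.pderiv j p)) t else 0 := by
    intro t
    have hi : (MeasurableEquiv.piFinSuccAbove (fun _ => ℝ) j).symm (t, y) =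
      (j.insertNth t y : Fin (n + 1) → ℝ) := rfl
    rw [hi, hf]
    by_cases hy : ∀ i, -1 ≤ y i
    · by_cases ht : t ∈ Set.Icc (-1) b
      · rw [Set.indicator_of_mem ((insertNth_mem_refSimplex j y t).mpr ⟨hy, ht⟩), if_pos hy,
          Set.indicator_of_mem ht]
      · rw [Set.indicator_of_notMem fun h => ht ((insertNth_mem_refSimplex j y t).mp h).2,
          if_pos hy, Set.indicator_of_notMem ht]
    · rw [Set.indicator_of_notMem fun h => hy ((insertNth_mem_refSimplex j y t).mp h).1, if_neg hy]
  simp only [hfy]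
  split_ifs with hy
  · rw [integral_indicator measurableSet_Icc]
    rcases le_or_gt (-1) b with hab | hab
    · rw [integral_Icc_eq_integral_Ioc, ← intervalIntegral.integral_of_le hab,
        intervalIntegral.integral_eq_sub_of_hasDerivAt
          (fun t _ => hasDerivAt_eval_insertNth j y p t), h1 _ (Fin.insertNth_apply_same j (-1) y), h2 _ ?_, sub_zero]
      · rw [Fin.sum_univ_succAbove _ j]
        simp only [Fin.insertNth_apply_same, Fin.insertNth_apply_succAbove, hb]
        ring
      · refine Continuous.intervalIntegrable ?_ _ _
        exact (MvPolynomial.continuous_eval _).comp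
          (Continuous.finInsertNth (A := fun _ => ℝ) j continuous_id continuous_const)
    · simp [Set.Icc_eq_empty hab.not_ge]
  · simp

/-! ### Moments of barycentric monomials -/

/-- The monomial `l_0^{α_0} ⋯ l_d^{α_d}` in the barycentric coordinates. -/
def baryMonomial (d : ℕ) (α : Fin (d + 1) → ℕ) : MvPolynomial (Fin d) ℝ :=
  ∏ j, bary d j ^ α j

theorem baryMonomial_add (d : ℕ) (α β : Fin (d + 1) → ℕ) :
    baryMonomial d (α + β) = baryMonomial d α * baryMonomial d β := by
  simp [baryMonomial, pow_add, Finset.prod_mul_distrib]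

@[simp]
theorem baryMonomial_zero (d : ℕ) : baryMonomial d 0 = 1 := by
  simp [baryMonomial]

@[simp]
theorem baryMonomial_single (d : ℕ) (j : Fin (d + 1)) :
    baryMonomial d (Pi.single j 1) = bary d j := by
  rw [baryMonomial, Finset.prod_eq_single j] <;> simp +contextual

theorem pderiv_bary_zero {d : ℕ} (j : Fin d) :
    MvPolynomial.pderiv j (bary d 0) = -MvPolynomial.C (1 / 2) := by
  simp only [bary, Fin.cons_zero, map_sub, map_sum, Derivation.leibniz, map_add]
  rw [Finset.sum_eq_single j] <;> simp +contextual

theorem pderiv_bary_succ {d : ℕ} (j i : Fin d) :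
    MvPolynomial.pderiv j (bary d i.succ) = if i = j then MvPolynomial.C (1 / 2) else 0 := by
  simp only [bary, Fin.cons_succ, Derivation.leibniz, map_add]
  split_ifs with h
  · subst h; simp
  · simp [MvPolynomial.pderiv_X_of_ne h]

/-- Integration by parts: P = l_0 l_{j+1} l^α vanishes on both faces required by
`simplexIntegral_pderiv`. In direction r_j only l_0 and l_{j+1} vary, with slopes -1/2 and 1/2, so
∂P/∂r_j is the difference of the two sides up to the factor 1/2. -/
theorem simplexIntegral_add_single_succ {d : ℕ} (α : Fin (d + 1) → ℕ) (j : Fin d) :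
    (α 0 + 1) * simplexIntegral d (baryMonomial d (α + Pi.single j.succ 1)) =
      (α j.succ + 1) * simplexIntegral d (baryMonomial d (α + Pi.single 0 1)) := by
  set R : MvPolynomial (Fin d) ℝ := ∏ k ∈ (Finset.univ.erase 0).erase j.succ, bary d k ^ α k with hR
  have hsplit : baryMonomial d α = bary d 0 ^ α 0 * (bary d j.succ ^ α j.succ * R) := by
    rw [hR, Finset.mul_prod_erase _ (fun k => bary d k ^ α k) (by simp),
      Finset.mul_prod_erase _ (fun k => bary d k ^ α k) (by simp), baryMonomial]
  have hdR : MvPolynomial.pderiv j R = 0 := by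
    refine Finset.prod_induction _ (fun q => MvPolynomial.pderiv j q = 0) ?_ (by simp) ?_
    · intro a b ha hb
      simp [Derivation.leibniz, ha, hb]
    · intro k hk
      simp only [Finset.mem_erase] at hk
      obtain ⟨i, rfl⟩ := Fin.exists_succ_eq.mpr hk.2.1
      have hij : i ≠ j := fun h => hk.1 (h ▸ rfl)
      simp [Derivation.leibniz_pow, pderiv_bary_succ, hij]
  set P : MvPolynomial (Fin d) ℝ := bary d 0 ^ (α 0 + 1) * (bary d j.succ ^ (α j.succ + 1) * R)
    with hP
  have h := simplexIntegral_pderiv j P ?_ ?_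
  · have hD : MvPolynomial.pderiv j P =
        (1 / 2 * (α j.succ + 1) : ℝ) • baryMonomial d (α + Pi.single 0 1) -
        (1 / 2 * (α 0 + 1) : ℝ) • baryMonomial d (α + Pi.single j.succ 1) := by
      simp only [hP, Derivation.leibniz, Derivation.leibniz_pow, hdR, pderiv_bary_zero,
        pderiv_bary_succ, baryMonomial_add, baryMonomial_single, hsplit, if_true,
        MvPolynomial.smul_eq_C_mul, smul_eq_mul, nsmul_eq_mul, Nat.add_sub_cancel, map_mul,
        map_add, map_one, map_natCast, mul_zero, zero_add]
      push_cast
      ring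
    rw [hD, map_sub, map_smul, map_smul, smul_eq_mul, smul_eq_mul] at h
    linarith
  · intro r hr
    simp [hP, bary, hr]
  · intro r hr
    simp only [hP, bary, Fin.cons_zero, map_mul, map_pow, map_sub, map_one, map_sum, map_add,
      MvPolynomial.eval_C, MvPolynomial.eval_X, ← Finset.mul_sum, hr]
    norm_num

/-- The integrals of l^α l_k are proportional to α_k + 1. They add up to the integral of l^α since ∑
l_k = 1, and the weights add up to |α| + d + 1. -/
theorem simplexIntegral_add_single {d : ℕ} (α : Fin (d + 1) → ℕ) (j : Fin (d + 1)) :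
    ((∑ k, α k : ℕ) + d + 1) * simplexIntegral d (baryMonomial d (α + Pi.single j 1)) =
      (α j + 1) * simplexIntegral d (baryMonomial d α) := by
  have hrel : ∀ k, (α 0 + 1) * simplexIntegral d (baryMonomial d (α + Pi.single k 1)) =
      (α k + 1) * simplexIntegral d (baryMonomial d (α + Pi.single 0 1)) := by
    intro k
    refine Fin.cases rfl (fun i => ?_) k
    exact simplexIntegral_add_single_succ α i
  have hsum : ∑ k, simplexIntegral d (baryMonomial d (α + Pi.single k 1)) =
      simplexIntegral d (baryMonomial d α) := by
    simp only [baryMonomial_add, baryMonomial_single]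
    rw [← map_sum, ← Finset.mul_sum, sum_bary, mul_one]
  have h0 : (α 0 + 1 : ℝ) ≠ 0 := by positivity
  have htot : (α 0 + 1) * simplexIntegral d (baryMonomial d α) =
      ((∑ k, α k : ℕ) + d + 1) * simplexIntegral d (baryMonomial d (α + Pi.single 0 1)) := by
    rw [← hsum, Finset.mul_sum, Finset.sum_congr rfl fun k _ => hrel k, ← Finset.sum_mul,
      Finset.sum_add_distrib]
    simp only [Finset.sum_const, Finset.card_univ, Fintype.card_fin, nsmul_eq_mul]
    push_cast
    ring
  refine mul_left_cancel₀ h0 ?_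
  linear_combination ((∑ k, α k : ℕ) + d + 1 : ℝ) * hrel j - (α j + 1 : ℝ) * htot

theorem exists_eq_add_single {n m : ℕ} {α : Fin n → ℕ} (h : ∑ k, α k = m + 1) :
    ∃ (β : Fin n → ℕ) (j : Fin n), α = β + Pi.single j 1 ∧ ∑ k, β k = m := by
  obtain ⟨j, -, hj⟩ := Finset.exists_ne_zero_of_sum_ne_zero (h.trans_ne m.succ_ne_zero)
  have hα : α = (α - Pi.single j 1) + Pi.single j 1 := by
    ext k
    by_cases hk : k = j
    · subst hk
      simp only [Pi.add_apply, Pi.sub_apply, Pi.single_eq_same]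
      omega
    · simp [Pi.single_eq_of_ne hk]
  refine ⟨_, j, hα, ?_⟩
  have h2 := congrArg (fun f : Fin n → ℕ => ∑ k, f k) hα
  simp only [Pi.add_apply, Finset.sum_add_distrib, Finset.sum_pi_single', Finset.mem_univ,
    if_true] at h2
  omega

theorem prod_factorial_add_single {n : ℕ} (α : Fin n → ℕ) (j : Fin n) :
    ∏ k, (((α + Pi.single j 1 : Fin n → ℕ) k)! : ℝ) = (α j + 1) * ∏ k, ((α k)! : ℝ) := by
  rw [← Finset.mul_prod_erase _ _ (Finset.mem_univ j),
    ← Finset.mul_prod_erase Finset.univ (fun k => ((α k)! : ℝ)) (Finset.mem_univ j), ← mul_assoc]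
  congr 1
  · simp [Nat.factorial_succ]
  · refine Finset.prod_congr rfl fun k hk => ?_
    simp [Pi.single_eq_of_ne (Finset.ne_of_mem_erase hk)]

/-- The Dirichlet integral over the reference simplex. -/
theorem simplexIntegral_baryMonomial {d : ℕ} (α : Fin (d + 1) → ℕ) :
    simplexIntegral d (baryMonomial d α) =
      simplexIntegral d 1 * d ! * (∏ k, ((α k)! : ℝ)) / ((∑ k, α k + d)! : ℝ) := by
  induction hm : ∑ k, α k generalizing α with
  | zero =>
    have h0 : α = 0 := by
      ext k
      exact Finset.sum_eq_zero_iff.mp hm k (Finset.mem_univ k)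
    subst h0
    have : (d ! : ℝ) ≠ 0 := by positivity
    simp [this]
  | succ m ih =>
    obtain ⟨β, j, rfl, hβ⟩ := exists_eq_add_single hm
    have h := simplexIntegral_add_single β j
    rw [ih β hβ, hβ] at h
    rw [prod_factorial_add_single, show m + 1 + d = (m + d) + 1 by ring, Nat.factorial_succ]
    have h1 : ((m + d)! : ℝ) ≠ 0 := by positivity
    have h2 : (m + d + 1 : ℝ) ≠ 0 := by positivity
    push_cast
    field_simp at h ⊢
    linear_combination h

/-! ### Bernstein expansions with binomial coefficients -/

theorem bernstein_eq_smul (d N : ℕ) (α : BernsteinIndex d N) :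
    bernstein d N α = ((N ! : ℝ) / ∏ j, ((α.1 j)! : ℝ)) • baryMonomial d α.1 := by
  rw [MvPolynomial.smul_eq_C_mul]
  rfl

theorem prod_factorial_ne_zero {n : ℕ} (α : Fin n → ℕ) : ∏ k, ((α k)! : ℝ) ≠ 0 :=
  Finset.prod_ne_zero_iff.mpr fun _ _ => Nat.cast_ne_zero.mpr (Nat.factorial_ne_zero _)

theorem BernsteinIndex.incr_injective {d n : ℕ} (j : Fin (d + 1)) :
    Function.Injective fun α : BernsteinIndex d n => α.incr j := by
  intro α β h
  exact Subtype.ext (add_right_cancel (congrArg Subtype.val h))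

/-- Reindexing by α ↦ α + e_j. Indices outside its range have α_j = 0, so the factor α_j removes
them and the truncated subtraction does no harm. -/
theorem smul_bary_mul_sum_bernstein {d n : ℕ} (j : Fin (d + 1)) (f : (Fin (d + 1) → ℕ) → ℝ) :
    (n + 1 : ℝ) • (bary d j * ∑ α : BernsteinIndex d n, f α.1 • bernstein d n α) =
      ∑ α : BernsteinIndex d (n + 1),
        (α.1 j * f (α.1 - Pi.single j 1)) • bernstein d (n + 1) α := by
  rw [Finset.mul_sum, Finset.smul_sum]
  refine Fintype.sum_of_injective _ (BernsteinIndex.incr_injective j) _ _ ?_ ?_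
  · intro α hα
    have h0 : α.1 j = 0 := by
      by_contra h
      refine hα ⟨⟨α.1 - Pi.single j 1, ?_⟩, Subtype.ext ?_⟩
      · have h1 := α.2
        rw [← Finset.add_sum_erase _ _ (Finset.mem_univ j)] at h1 ⊢
        rw [Finset.sum_congr (g := fun k => α.1 k) rfl fun k hk => show (α.1 - Pi.single j 1 : Fin (d + 1) → ℕ) k = α.1 k by
          simp [Pi.single_eq_of_ne (Finset.ne_of_mem_erase hk)]]
        simp only [Pi.sub_apply, Pi.single_eq_same]
        omega
      · refine tsub_add_cancel_of_le ?_
        intro k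
        by_cases hk : k = j
        · subst hk
          simpa using Nat.one_le_iff_ne_zero.mpr h
        · simp [Pi.single_eq_of_ne hk]
    simp [h0]
  · intro α
    have h1 : (n + 1 : ℝ) ≠ 0 := by positivity
    simp only [BernsteinIndex.incr, add_tsub_cancel_right]
    rw [mul_smul_comm, bary_mul_bernstein, smul_smul, smul_smul, BernsteinIndex.incr]
    congr 1
    simp only [Pi.add_apply, Pi.single_eq_same]
    push_cast
    field_simp

theorem sum_bernstein (d N : ℕ) : ∑ α : BernsteinIndex d N, bernstein d N α = 1 := by
  induction N with
  | zero =>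
    have hα : ∀ α : BernsteinIndex d 0, α = ⟨0, by simp⟩ := fun α =>
      Subtype.ext (funext fun k => Finset.sum_eq_zero_iff.mp α.2 k (Finset.mem_univ k))
    rw [Fintype.sum_eq_single ⟨0, by simp⟩ fun α h => (h (hα α)).elim]
    simp [bernstein]
  | succ n ih =>
    have h : ∀ j, (n + 1 : ℝ) • bary d j =
        ∑ α : BernsteinIndex d (n + 1), (α.1 j : ℝ) • bernstein d (n + 1) α := by
      intro j
      have := smul_bary_mul_sum_bernstein (n := n) j fun _ => 1
      simpa [ih] using this
    have h1 : (n + 1 : ℝ) ≠ 0 := by positivity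
    refine smul_right_injective _ h1 ?_
    dsimp only
    rw [← sum_bary d, Finset.smul_sum, Finset.smul_sum, Finset.sum_congr rfl fun j _ => h j,
      Finset.sum_comm]
    refine Finset.sum_congr rfl fun α _ => ?_
    rw [← Finset.sum_smul, ← Nat.cast_sum, α.2]
    push_cast
    rfl

/-- Only the j-th factor changes, by (b+1) C(a, b+1) = a C(a-1, b); for a = 0 both sides vanish
despite truncated subtraction. -/
theorem prod_choose_add_single {n : ℕ} (α β : Fin n → ℕ) (j : Fin n) :
    (β j + 1) * ∏ k, (α k).choose ((β + Pi.single j 1 : Fin n → ℕ) k) =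
      α j * ∏ k, ((α - Pi.single j 1 : Fin n → ℕ) k).choose (β k) := by
  have hα : (α - Pi.single j 1 : Fin n → ℕ) j = α j - 1 := by simp
  have hα' : ∀ k ≠ j, (α - Pi.single j 1 : Fin n → ℕ) k = α k := fun k hk => by
    simp [Pi.single_eq_of_ne hk]
  generalize (α - Pi.single j 1 : Fin n → ℕ) = γ at hα hα' ⊢
  rw [← Finset.mul_prod_erase _ _ (Finset.mem_univ j),
    ← Finset.mul_prod_erase Finset.univ (fun k => (γ k).choose (β k)) (Finset.mem_univ j),
    ← mul_assoc, ← mul_assoc]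
  congr 1
  · simp only [Pi.add_apply, Pi.single_eq_same, hα]
    rcases Nat.eq_zero_or_pos (α j) with h | h
    · simp [h]
    · obtain ⟨m, hm⟩ := Nat.exists_eq_add_of_lt h
      rw [zero_add] at hm
      rw [hm, Nat.add_sub_cancel, mul_comm]
      exact (Nat.add_one_mul_choose_eq m (β j)).symm
  · refine Finset.prod_congr rfl fun k hk => ?_
    rw [hα' k (Finset.ne_of_mem_erase hk)]
    simp [Pi.single_eq_of_ne (Finset.ne_of_mem_erase hk)]

/-- These are the factorial moments of the multinomial distribution with probabilities l_j. The
induction on |b| splits off one factor l_j and lowers N by one. -/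
theorem sum_prod_choose_smul_bernstein (d N : ℕ) (b : Fin (d + 1) → ℕ) :
    ∑ α : BernsteinIndex d N, (∏ j, ((α.1 j).choose (b j) : ℝ)) • bernstein d N α =
      ((N.descFactorial (∑ j, b j) : ℝ) / ∏ j, ((b j)! : ℝ)) • baryMonomial d b := by
  induction hm : ∑ j, b j generalizing b N with
  | zero =>
    have h0 : b = 0 := funext fun k => Finset.sum_eq_zero_iff.mp hm k (Finset.mem_univ k)
    subst h0
    simpa using sum_bernstein d N
  | succ m ih =>
    obtain ⟨β, j, rfl, hβ⟩ := exists_eq_add_single hm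
    have hj : (β j + 1 : ℝ) ≠ 0 := by positivity
    obtain _ | n := N
    · rw [Nat.zero_descFactorial_succ, Nat.cast_zero, zero_div, zero_smul]
      refine Finset.sum_eq_zero fun α _ => ?_
      have h0 : α.1 j = 0 := Finset.sum_eq_zero_iff.mp α.2 j (Finset.mem_univ j)
      rw [Finset.prod_eq_zero (Finset.mem_univ j), zero_smul]
      simp [h0]
    · refine smul_right_injective _ hj ?_
      have h := smul_bary_mul_sum_bernstein (n := n) j
        fun α => ∏ k, ((α k).choose (β k) : ℝ)
      have h2 := ih n β hβ
      rw [h2] at h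
      dsimp only
      calc _ = _ := by
            rw [Finset.smul_sum]
            refine Finset.sum_congr rfl fun α _ => ?_
            rw [smul_smul]
            congr 1
            exact_mod_cast prod_choose_add_single α.1 β j
        _ = _ := h.symm
        _ = _ := by
            rw [prod_factorial_add_single, baryMonomial_add, baryMonomial_single,
              Nat.succ_descFactorial_succ, mul_smul_comm, smul_smul, smul_smul,
              mul_comm (bary d j)]
            congr 1
            have := prod_factorial_ne_zero β
            push_cast
            field_simp

/-- Vandermonde for C(m+a, a), multiplied by a!. It puts the rising product (m+1)⋯(m+a) in the
binomial form that `sum_prod_choose_smul_bernstein` can sum. -/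
theorem factorial_add_eq_sum (m a : ℕ) :
    ((m + a)! : ℝ) / (m ! : ℝ) =
      ∑ b ∈ Finset.range (a + 1), ((a ! * a.choose b : ℕ) : ℝ) * (m.choose b : ℝ) := by
  have h1 : ((m + a)! : ℝ) = (m + a).choose a * m ! * a ! := by
    exact_mod_cast (Nat.add_choose_mul_factorial_mul_factorial m a).symm
  have h2 : (m ! : ℝ) ≠ 0 := by positivity
  have h3 : (m + a).choose a = ∑ b ∈ Finset.range (a + 1), m.choose b * a.choose b := by
    rw [Nat.add_choose_eq, Finset.Nat.sum_antidiagonal_eq_sum_range_succ_mk]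
    refine Finset.sum_congr rfl fun b hb => ?_
    rw [Nat.choose_symm (Finset.mem_range_succ_iff.mp hb)]
  rw [h1, h3]
  push_cast
  rw [mul_right_comm, mul_div_cancel_right₀ _ h2, Finset.sum_mul]
  exact Finset.sum_congr rfl fun b _ => by ring

/-! ### The operator represented by the mass matrix -/

/-- The bilinear form `simplexInner`. -/
def simplexForm (d : ℕ) : LinearMap.BilinForm ℝ (MvPolynomial (Fin d) ℝ) :=
  (LinearMap.mul ℝ (MvPolynomial (Fin d) ℝ)).compr₂ (simplexIntegral d)

theorem simplexForm_apply (d : ℕ) (p q : MvPolynomial (Fin d) ℝ) :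
    simplexForm d p q = simplexInner d p q :=
  (simplexInner_eq d p q).symm

/-- The Bernstein–Durrmeyer operator `p ↦ ∑_α ⟨p, B^N_α⟩ B^N_α`. -/
def durrmeyer (d N : ℕ) : MvPolynomial (Fin d) ℝ →ₗ[ℝ] MvPolynomial (Fin d) ℝ :=
  ∑ α : BernsteinIndex d N, ((simplexForm d).flip (bernstein d N α)).smulRight (bernstein d N α)

theorem durrmeyer_apply (d N : ℕ) (p : MvPolynomial (Fin d) ℝ) :
    durrmeyer d N p = ∑ α : BernsteinIndex d N,
      simplexInner d p (bernstein d N α) • bernstein d N α := by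
  simp [durrmeyer, simplexForm_apply]

theorem simplexForm_durrmeyer_left (d N : ℕ) (p q : MvPolynomial (Fin d) ℝ) :
    simplexForm d (durrmeyer d N p) q = simplexForm d p (durrmeyer d N q) := by
  simp only [durrmeyer_apply, map_sum, map_smul, LinearMap.sum_apply, LinearMap.smul_apply,
    smul_eq_mul, simplexForm_apply]
  refine Finset.sum_congr rfl fun α _ => ?_
  rw [mul_comm, simplexInner_comm d q]

theorem simplexInner_baryMonomial_bernstein {d N : ℕ} (a : Fin (d + 1) → ℕ)
    (α : BernsteinIndex d N) :
    simplexInner d (baryMonomial d a) (bernstein d N α) =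
      simplexIntegral d 1 * d ! * N ! / ((N + ∑ j, a j + d)! : ℝ) *
        ∏ j, (((α.1 j + a j)! : ℝ) / ((α.1 j)! : ℝ)) := by
  have h := prod_factorial_ne_zero α.1
  rw [simplexInner_eq, bernstein_eq_smul, mul_smul_comm, ← baryMonomial_add, add_comm a, map_smul,
    simplexIntegral_baryMonomial, Finset.prod_div_distrib]
  simp only [Pi.add_apply, Finset.sum_add_distrib, α.2, smul_eq_mul]
  field_simp

/-- The explicit triangular form of the operator: only monomials l^b with b ≤ a occur, so the degree
never grows and b = a is the sole index of full weight. -/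
theorem durrmeyer_baryMonomial (d N : ℕ) (a : Fin (d + 1) → ℕ) :
    durrmeyer d N (baryMonomial d a) =
      ∑ b ∈ Fintype.piFinset fun j => Finset.range (a j + 1),
        (simplexIntegral d 1 * d ! * N ! / ((N + ∑ j, a j + d)! : ℝ) *
          ((∏ j, (((a j)! * (a j).choose (b j) : ℕ) : ℝ)) *
            ((N.descFactorial (∑ j, b j) : ℝ) / ∏ j, ((b j)! : ℝ)))) • baryMonomial d b := by
  rw [durrmeyer_apply]
  simp only [simplexInner_baryMonomial_bernstein, factorial_add_eq_sum, Finset.prod_univ_sum,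
    Finset.prod_mul_distrib, Finset.mul_sum, Finset.sum_smul]
  rw [Finset.sum_comm]
  refine Finset.sum_congr rfl fun b _ => ?_
  simp only [mul_smul]
  rw [← sum_prod_choose_smul_bernstein, Finset.smul_sum, Finset.smul_sum]

/-- The eigenvalue of the mass matrix `M_N` on the orthogonal complement of `P^{k-1}` in `P^k`. -/
def durrmeyerEigenvalue (d N k : ℕ) : ℝ :=
  simplexIntegral d 1 * d ! * N ! / ((N + k + d)! : ℝ) * N.descFactorial k

/-- Polynomials of total degree less than `k`. -/
def polySpaceLT (d : ℕ) : ℕ → Submodule ℝ (MvPolynomial (Fin d) ℝ)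
  | 0 => ⊥
  | k + 1 => polySpace d k

theorem baryMonomial_mem_polySpace (d : ℕ) (a : Fin (d + 1) → ℕ) :
    baryMonomial d a ∈ polySpace d (∑ j, a j) := by
  have h := bernstein_mem d (∑ j, a j) ⟨a, rfl⟩
  rw [bernstein_eq_smul] at h
  refine (Submodule.smul_mem_iff _ ?_).mp h
  have := prod_factorial_ne_zero a
  positivity

theorem polySpaceLT_le (d k : ℕ) : polySpaceLT d k ≤ polySpace d k := by
  cases k with
  | zero => exact bot_le
  | succ k => exact polySpace_mono d k.le_succ

theorem polySpace_le_polySpaceLT (d : ℕ) {m k : ℕ} (h : m < k) :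
    polySpace d m ≤ polySpaceLT d k := by
  cases k with
  | zero => exact absurd h (Nat.not_lt_zero _)
  | succ k => exact polySpace_mono d (Nat.le_of_lt_succ h)

theorem durrmeyer_sub_mem (d N : ℕ) {k : ℕ} {p : MvPolynomial (Fin d) ℝ} (hp : p ∈ polySpace d k) :
    durrmeyer d N p - durrmeyerEigenvalue d N k • p ∈ polySpaceLT d k := by
  have hspan := polySpace_le_span d k hp
  suffices h : Submodule.span ℝ (Set.range (bernstein d k)) ≤ (polySpaceLT d k).comap
      (durrmeyer d N - durrmeyerEigenvalue d N k • LinearMap.id) from h hspan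
  rw [Submodule.span_le]
  rintro _ ⟨α, rfl⟩
  rw [bernstein_eq_smul]
  refine Submodule.smul_mem _ _ ?_
  simp only [Submodule.mem_comap, LinearMap.sub_apply, LinearMap.smul_apply, LinearMap.id_apply]
  obtain ⟨a, rfl⟩ := α
  have ha : a ∈ Fintype.piFinset fun j => Finset.range (a j + 1) := by simp
  rw [durrmeyer_baryMonomial, ← Finset.add_sum_erase _ _ ha]
  -- For b = a the product of the a_j! cancels, so the leading coefficient depends on a only through
  -- |a|.
  have htop : (∏ j, (((a j)! * (a j).choose (a j) : ℕ) : ℝ)) *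
      ((N.descFactorial (∑ j, a j) : ℝ) / ∏ j, ((a j)! : ℝ)) = N.descFactorial (∑ j, a j) := by
    simp only [Nat.choose_self, mul_one]
    exact mul_div_cancel₀ _ (prod_factorial_ne_zero a)
  rw [htop, durrmeyerEigenvalue, add_sub_cancel_left]
  refine Submodule.sum_mem _ fun b hb => Submodule.smul_mem _ _ ?_
  refine polySpace_le_polySpaceLT d ?_ (baryMonomial_mem_polySpace d b)
  simp only [Finset.mem_erase, Fintype.mem_piFinset, Finset.mem_range_succ_iff] at hb
  obtain ⟨j, hj⟩ := Function.ne_iff.mp hb.1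
  exact Finset.sum_lt_sum (fun k _ => hb.2 k) ⟨j, Finset.mem_univ j, lt_of_le_of_ne (hb.2 j) hj⟩

theorem durrmeyer_mem (d N : ℕ) {k : ℕ} {p : MvPolynomial (Fin d) ℝ} (hp : p ∈ polySpace d k) :
    durrmeyer d N p ∈ polySpace d k := by
  have h := polySpaceLT_le d k (durrmeyer_sub_mem d N hp)
  exact (Submodule.sub_mem_iff_left _ (Submodule.smul_mem _ _ hp)).mp h

theorem durrmeyer_mem_polySpaceLT (d N : ℕ) {k : ℕ} {p : MvPolynomial (Fin d) ℝ}
    (hp : p ∈ polySpaceLT d k) : durrmeyer d N p ∈ polySpaceLT d k := by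
  cases k with
  | zero =>
    rw [(Submodule.mem_bot ℝ).mp hp, map_zero]
    exact Submodule.zero_mem _
  | succ k => exact durrmeyer_mem d N hp

/-- The defect q = D p - λ p has degree below k. Since D is self-adjoint and preserves that space,
⟨q, q⟩ = ⟨p, D q⟩ - λ⟨p, q⟩ = 0. -/
theorem durrmeyer_eq_smul (d N : ℕ) {k : ℕ} {p : MvPolynomial (Fin d) ℝ} (hp : p ∈ polySpace d k)
    (horth : ∀ q ∈ polySpaceLT d k, simplexForm d p q = 0) :
    durrmeyer d N p = durrmeyerEigenvalue d N k • p := by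
  rw [← sub_eq_zero]
  set q := durrmeyer d N p - durrmeyerEigenvalue d N k • p with hq
  have hmem : q ∈ polySpaceLT d k := durrmeyer_sub_mem d N hp
  refine eq_zero_of_simplexInner_self ?_
  rw [← simplexForm_apply]
  have hsplit : simplexForm d q q =
      simplexForm d (durrmeyer d N p) q - durrmeyerEigenvalue d N k * simplexForm d p q := by
    rw [← smul_eq_mul, ← LinearMap.smul_apply, ← map_smul, ← LinearMap.sub_apply, ← map_sub]
  rw [hsplit, simplexForm_durrmeyer_left, horth _ (durrmeyer_mem_polySpaceLT d N hmem), horth _ hmem,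
    mul_zero, sub_zero]

theorem durrmeyerEigenvalue_pos (d : ℕ) {N k : ℕ} (h : k ≤ N) : 0 < durrmeyerEigenvalue d N k := by
  have h1 := simplexIntegral_one_pos d
  have h2 : 0 < N.descFactorial k := Nat.descFactorial_pos.mpr h
  rw [durrmeyerEigenvalue]
  positivity

/-- The ratio of consecutive values is (N-k)/(N+k+d+1) < 1. -/
theorem durrmeyerEigenvalue_succ_lt (d : ℕ) {N k : ℕ} (h : k ≤ N) :
    durrmeyerEigenvalue d N (k + 1) < durrmeyerEigenvalue d N k := by
  have h1 := durrmeyerEigenvalue_pos d h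
  have h2 : durrmeyerEigenvalue d N (k + 1) =
      durrmeyerEigenvalue d N k * ((N - k) / (N + k + d + 1)) := by
    rw [durrmeyerEigenvalue, durrmeyerEigenvalue, Nat.descFactorial_succ,
      show N + (k + 1) + d = (N + k + d) + 1 by ring, Nat.factorial_succ, Nat.cast_mul,
      Nat.cast_mul, Nat.cast_sub h]
    push_cast
    field_simp
  rw [h2]
  refine mul_lt_of_lt_one_right h1 ?_
  rw [div_lt_one (by positivity)]
  have : (0 : ℝ) ≤ k := by positivity
  have : (0 : ℝ) ≤ d := by positivity
  linarith

theorem durrmeyerEigenvalue_lt (d : ℕ) {N j k : ℕ} (hjk : j < k) (hk : k ≤ N) :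
    durrmeyerEigenvalue d N k < durrmeyerEigenvalue d N j := by
  induction k, hjk using Nat.le_induction with
  | base => exact durrmeyerEigenvalue_succ_lt d (Nat.le_of_succ_le hk)
  | succ k hjk ih =>
    exact (durrmeyerEigenvalue_succ_lt d (Nat.le_of_succ_le hk)).trans (ih (Nat.le_of_succ_le hk))

/-! ### Diagonalisation of the mass matrix in a modal basis -/

section Modal

variable {d : ℕ} {L : (Fin d → ℕ) → MvPolynomial (Fin d) ℝ}

theorem IsModalBasis.mem_polySpace (hL : IsModalBasis d L) (γ : Fin d → ℕ) :
    L γ ∈ polySpace d (∑ j, γ j) := by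
  rw [← hL.span_eq]
  exact Submodule.subset_span ⟨γ, le_refl (∑ j, γ j), rfl⟩

theorem IsModalBasis.simplexForm_eq_zero (hL : IsModalBasis d L) (γ : Fin d → ℕ)
    {q : MvPolynomial (Fin d) ℝ} (hq : q ∈ polySpaceLT d (∑ j, γ j)) :
    simplexForm d (L γ) q = 0 := by
  generalize hk : ∑ j, γ j = k at hq
  cases k with
  | zero => rw [(Submodule.mem_bot ℝ).mp hq, map_zero]
  | succ k =>
    have hq' : q ∈ Submodule.span ℝ (L '' {γ | ∑ j, γ j ≤ k}) := by
      rw [hL.span_eq]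
      exact hq
    suffices h : Submodule.span ℝ (L '' {γ | ∑ j, γ j ≤ k}) ≤
        LinearMap.ker (simplexForm d (L γ)) from h hq'
    rw [Submodule.span_le]
    rintro _ ⟨ν, hν, rfl⟩
    refine (simplexForm_apply d _ _).trans (hL.orthogonal γ ν ?_)
    rintro rfl
    have : ∑ j, γ j ≤ k := hν
    omega

theorem IsModalBasis.durrmeyer_apply (hL : IsModalBasis d L) (N : ℕ) (γ : Fin d → ℕ) :
    durrmeyer d N (L γ) = durrmeyerEigenvalue d N (∑ j, γ j) • L γ :=
  durrmeyer_eq_smul d N (hL.mem_polySpace γ) fun _ hq => hL.simplexForm_eq_zero γ hq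

theorem IsModalBasis.sum_transform_smul (hL : IsModalBasis d L) (N : ℕ) (γ : ModalIndex d N) :
    ∑ α, hL.transform N α γ • bernstein d N α = L γ.1 := by
  rw [← hL.coe_basis N γ]
  conv_rhs => rw [← (bernsteinBasis d N).sum_repr (hL.basis N γ)]
  simp only [Submodule.coe_sum, Submodule.coe_smul, coe_bernsteinBasis]
  rfl

theorem bernstein_linearIndependent (d N : ℕ) : LinearIndependent ℝ (bernstein d N) := by
  have h := (bernsteinBasis d N).linearIndependent.map' (polySpace d N).subtype
    (Submodule.ker_subtype _)
  have hfun : bernstein d N = (polySpace d N).subtype ∘ bernsteinBasis d N := by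
    ext1 α
    simp
  rw [hfun]
  exact h

/-- Entry (α, γ) of M_N T_N is ⟨L_γ, B_α⟩, the coefficient of B_α in D_N L_γ; comparing with the
eigenvalue equation uses independence of the Bernstein polynomials. -/
theorem IsModalBasis.massMatrix_mul_transform (hL : IsModalBasis d L) (N : ℕ) :
    massMatrix d N * hL.transform N = hL.transform N *
      Matrix.diagonal fun γ : ModalIndex d N => durrmeyerEigenvalue d N (∑ j, γ.1 j) := by
  ext α γ
  rw [Matrix.mul_diagonal, Matrix.mul_apply]
  have h1 : ∑ β, massMatrix d N α β * hL.transform N β γ =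
      simplexInner d (L γ.1) (bernstein d N α) := by
    rw [← hL.sum_transform_smul N γ, ← simplexForm_apply, map_sum, LinearMap.sum_apply]
    refine Finset.sum_congr rfl fun β _ => ?_
    rw [map_smul, LinearMap.smul_apply, simplexForm_apply, smul_eq_mul, mul_comm]
    rfl
  rw [h1]
  have h2 := hL.durrmeyer_apply N γ.1
  rw [BernsteinSimplex.durrmeyer_apply] at h2
  nth_rewrite 2 [← hL.sum_transform_smul N γ] at h2
  rw [Finset.smul_sum] at h2
  simp only [smul_smul] at h2
  have h3 := Fintype.linearIndependent_iffₛ.mp (bernstein_linearIndependent d N) _ _ h2 α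
  rw [h3, mul_comm]

theorem IsModalBasis.transpose_mul_massMatrix_mul (hL : IsModalBasis d L) (N : ℕ) :
    (hL.transform N)ᵀ * (massMatrix d N * hL.transform N) =
      Matrix.diagonal fun γ : ModalIndex d N => simplexInner d (L γ.1) (L γ.1) := by
  ext ν γ
  have h1 : ((hL.transform N)ᵀ * (massMatrix d N * hL.transform N)) ν γ =
      simplexInner d (L γ.1) (L ν.1) := by
    rw [← hL.sum_transform_smul N γ, ← hL.sum_transform_smul N ν, ← simplexForm_apply]
    simp only [Matrix.mul_apply, Matrix.transpose_apply, map_sum, map_smul, LinearMap.sum_apply,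
      LinearMap.smul_apply, smul_eq_mul, Finset.mul_sum, simplexForm_apply]
    refine Finset.sum_congr rfl fun α _ => Finset.sum_congr rfl fun β _ => ?_
    rw [massMatrix, Matrix.of_apply]
    ring
  rw [h1, Matrix.diagonal_apply]
  split_ifs with h
  · rw [h]
  · exact hL.orthogonal _ _ fun h' => h (Subtype.ext h'.symm)

/-- The Bernstein coefficient vectors of the L_γ are orthogonal in the Euclidean sense too, and N
enters their squared lengths only through the eigenvalue. -/
theorem IsModalBasis.transpose_mul_transform (hL : IsModalBasis d L) (N : ℕ) :
    (hL.transform N)ᵀ * hL.transform N = Matrix.diagonal fun γ : ModalIndex d N =>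
      simplexInner d (L γ.1) (L γ.1) / durrmeyerEigenvalue d N (∑ j, γ.1 j) := by
  have h := hL.transpose_mul_massMatrix_mul N
  rw [hL.massMatrix_mul_transform, ← Matrix.mul_assoc] at h
  ext ν γ
  have h2 := congrFun (congrFun h ν) γ
  have h3 := (durrmeyerEigenvalue_pos d γ.2).ne'
  rw [Matrix.mul_diagonal] at h2
  rw [eq_div_of_mul_eq h3 h2, Matrix.diagonal_apply, Matrix.diagonal_apply]
  split_ifs with hνγ
  · rw [hνγ]
  · exact zero_div _

/-! ### Degree elevation in a modal basis -/

/-- The matrix of the inclusion of `P^n` into `P^N` in modal bases. -/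
def modalInclusion (d n N : ℕ) : Matrix (ModalIndex d N) (ModalIndex d n) ℝ :=
  Matrix.of fun γ ν => if γ.1 = ν.1 then 1 else 0

/-- The modal basis is hierarchical: the inclusion sends each L_ν to the same L_ν. -/
theorem IsModalBasis.elevation_mul_transform (hL : IsModalBasis d L) {n N : ℕ} (h : n ≤ N) :
    elevation d h * hL.transform n = hL.transform N * modalInclusion d n N := by
  have h1 : LinearMap.toMatrix (hL.basis n) (hL.basis N)
      (Submodule.inclusion (polySpace_mono d h)) = modalInclusion d n N := by
    ext γ ν
    have h2 : Submodule.inclusion (polySpace_mono d h) (hL.basis n ν) =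
        hL.basis N ⟨ν.1, ν.2.trans h⟩ := by
      apply Subtype.ext
      simp
    rw [LinearMap.toMatrix_apply, h2, Basis.repr_self, Finsupp.single_apply, modalInclusion,
      Matrix.of_apply]
    simp only [Subtype.ext_iff, eq_comm]
  rw [← h1, IsModalBasis.transform, IsModalBasis.transform, elevation,
    linearMap_toMatrix_mul_basis_toMatrix, basis_toMatrix_mul_linearMap_toMatrix]

/-- Both sides agree after multiplication by the invertible T_nᵀ, where the Gram formulas in degrees
n and N apply and the common squared norms match. -/
theorem IsModalBasis.transpose_elevation_mul_transform (hL : IsModalBasis d L) {n N : ℕ}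
    (h : n ≤ N) :
    (elevation d h)ᵀ * hL.transform N = hL.transform n *
      ((Matrix.diagonal fun γ : ModalIndex d n => durrmeyerEigenvalue d n (∑ j, γ.1 j)) *
        (modalInclusion d n N)ᵀ *
        Matrix.diagonal fun γ : ModalIndex d N => (durrmeyerEigenvalue d N (∑ j, γ.1 j))⁻¹) := by
  have hinv : (hL.transformInv n)ᵀ * (hL.transform n)ᵀ = 1 := by
    rw [← Matrix.transpose_mul, hL.transform_mul_transformInv, Matrix.transpose_one]
  have key : (hL.transform n)ᵀ * ((elevation d h)ᵀ * hL.transform N) = (hL.transform n)ᵀ *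
      (hL.transform n *
      ((Matrix.diagonal fun γ : ModalIndex d n => durrmeyerEigenvalue d n (∑ j, γ.1 j)) *
        (modalInclusion d n N)ᵀ *
        Matrix.diagonal fun γ : ModalIndex d N => (durrmeyerEigenvalue d N (∑ j, γ.1 j))⁻¹)) := by
    rw [← Matrix.mul_assoc, ← Matrix.transpose_mul, hL.elevation_mul_transform,
      Matrix.transpose_mul, Matrix.mul_assoc, hL.transpose_mul_transform, ← Matrix.mul_assoc,
      hL.transpose_mul_transform]
    ext ν γ
    have h3 := (durrmeyerEigenvalue_pos d ν.2).ne'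
    rw [Matrix.mul_diagonal, Matrix.diagonal_mul, Matrix.mul_diagonal, Matrix.diagonal_mul,
      Matrix.transpose_apply, modalInclusion, Matrix.of_apply]
    split_ifs with hνγ
    · rw [hνγ]
      field_simp
    · simp
  have := congrArg (fun A => (hL.transformInv n)ᵀ * A) key
  simpa only [← Matrix.mul_assoc, hinv, Matrix.one_mul] using this

theorem IsModalBasis.transformInv_elevation_transform (hL : IsModalBasis d L) {n N : ℕ}
    (h : n ≤ N) :
    hL.transformInv N * (elevation d h * (elevation d h)ᵀ) * hL.transform N =
      Matrix.diagonal fun γ : ModalIndex d N => if n < ∑ j, γ.1 j then 0 else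
        durrmeyerEigenvalue d n (∑ j, γ.1 j) / durrmeyerEigenvalue d N (∑ j, γ.1 j) := by
  rw [Matrix.mul_assoc, Matrix.mul_assoc, hL.transpose_elevation_mul_transform,
    ← Matrix.mul_assoc (elevation d h), hL.elevation_mul_transform, Matrix.mul_assoc,
    ← Matrix.mul_assoc, hL.transformInv_mul_transform, Matrix.one_mul]
  ext ν γ
  rw [← Matrix.mul_assoc, Matrix.mul_diagonal, Matrix.mul_apply, Matrix.diagonal_apply]
  simp only [Matrix.diagonal_mul, Matrix.transpose_apply, modalInclusion, Matrix.of_apply]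
  by_cases hγ : n < ∑ j, γ.1 j
  · rw [Finset.sum_eq_zero, zero_mul]
    · by_cases hνγ : ν = γ
      · rw [if_pos hνγ, hνγ, if_pos hγ]
      · rw [if_neg hνγ]
    · intro κ _
      have : γ.1 ≠ κ.1 := by
        intro hκ
        rw [hκ] at hγ
        exact absurd κ.2 hγ.not_ge
      simp [this]
  · rw [Fintype.sum_eq_single ⟨γ.1, not_lt.mp hγ⟩]
    · by_cases hνγ : ν = γ
      · subst hνγ
        simp [hγ, div_eq_mul_inv]
      · have : ν.1 ≠ γ.1 := fun h => hνγ (Subtype.ext h)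
        simp [this, hνγ]
    · intro κ hκ
      have : γ.1 ≠ κ.1 := fun h => hκ (Subtype.ext h.symm)
      simp [this]

end Modal

/-! ### The spectrum of the mass matrix -/

/-- Similarity across different index types: if R inverts μ - B, then P R Q inverts μ - A. -/
theorem spectrum_subset_of_mul_eq {m n : Type*} [Fintype m] [Fintype n] [DecidableEq m]
    [DecidableEq n] {A : Matrix m m ℝ} {B : Matrix n n ℝ} {P : Matrix m n ℝ} {Q : Matrix n m ℝ}
    (hPQ : P * Q = 1) (h : A * P = P * B) : spectrum ℝ A ⊆ spectrum ℝ B := by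
  intro μ hμ
  rw [spectrum.mem_iff] at hμ ⊢
  contrapose hμ
  obtain ⟨R, hR, -⟩ := isUnit_iff_exists.mp hμ
  have hA : (algebraMap ℝ (Matrix m m ℝ) μ - A) * P = P * (algebraMap ℝ (Matrix n n ℝ) μ - B) := by
    rw [Matrix.sub_mul, Matrix.mul_sub, h, Algebra.algebraMap_eq_smul_one,
      Algebra.algebraMap_eq_smul_one]
    simp
  have hinv : (algebraMap ℝ (Matrix m m ℝ) μ - A) * (P * R * Q) = 1 := by
    rw [← Matrix.mul_assoc, ← Matrix.mul_assoc, hA, Matrix.mul_assoc P, hR, Matrix.mul_one, hPQ]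
  -- For square matrices a one-sided inverse suffices.
  exact IsUnit.of_mul_eq_one _ hinv

theorem spectrum_eq_of_mul_eq {m n : Type*} [Fintype m] [Fintype n] [DecidableEq m] [DecidableEq n]
    {A : Matrix m m ℝ} {B : Matrix n n ℝ} {P : Matrix m n ℝ} {Q : Matrix n m ℝ}
    (hPQ : P * Q = 1) (hQP : Q * P = 1) (h : A * P = P * B) : spectrum ℝ A = spectrum ℝ B := by
  refine (spectrum_subset_of_mul_eq hPQ h).antisymm (spectrum_subset_of_mul_eq hQP ?_)
  calc B * Q = Q * P * B * Q := by rw [hQP, Matrix.one_mul]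
    _ = Q * A * (P * Q) := by
      rw [Matrix.mul_assoc Q P, ← h]
      simp only [Matrix.mul_assoc]
    _ = Q * A := by rw [hPQ, Matrix.mul_one]

theorem spectrum_massMatrix {d : ℕ} (hd : 1 ≤ d) {L : (Fin d → ℕ) → MvPolynomial (Fin d) ℝ}
    (hL : IsModalBasis d L) (N : ℕ) :
    spectrum ℝ (massMatrix d N) =
      ((Finset.range (N + 1)).image (durrmeyerEigenvalue d N) : Finset ℝ) := by
  rw [spectrum_eq_of_mul_eq (hL.transform_mul_transformInv N) (hL.transformInv_mul_transform N)
    (hL.massMatrix_mul_transform N), spectrum_diagonal]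
  ext μ
  simp only [Set.mem_range, Finset.coe_image, Set.mem_image, Finset.coe_range, Set.mem_Iio]
  constructor
  · rintro ⟨γ, rfl⟩
    exact ⟨_, Nat.lt_succ_of_le γ.2, rfl⟩
  · rintro ⟨k, hk, rfl⟩
    -- Every degree k is attained by some γ because d ≥ 1; for d = 0 only k = 0 would occur.
    have hsum : ∑ j, (Pi.single (⟨0, hd⟩ : Fin d) k : Fin d → ℕ) j = k := by simp
    exact ⟨⟨Pi.single ⟨0, hd⟩ k, hsum.le.trans (Nat.le_of_lt_succ hk)⟩, by rw [hsum]⟩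

theorem durrmeyerEigenvalue_injOn (d N : ℕ) :
    Set.InjOn (durrmeyerEigenvalue d N) (Finset.range (N + 1)) := by
  intro j hj k hk h
  simp only [Finset.coe_range, Set.mem_Iio] at hj hk
  rcases lt_trichotomy j k with hjk | hjk | hjk
  · exact absurd h (durrmeyerEigenvalue_lt d hjk (Nat.le_of_lt_succ hk)).ne'
  · exact hjk
  · exact absurd h (durrmeyerEigenvalue_lt d hjk (Nat.le_of_lt_succ hj)).ne

/-- The list λ_0, …, λ_N is strictly decreasing and has the spectrum as its set of entries, so it is
the sorted spectrum. -/
theorem massEigenvalue_eq {d : ℕ} (hd : 1 ≤ d) {L : (Fin d → ℕ) → MvPolynomial (Fin d) ℝ}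
    (hL : IsModalBasis d L) {N k : ℕ} (hk : k ≤ N) :
    massEigenvalue d N k = durrmeyerEigenvalue d N k := by
  set l : List ℝ := (List.range (N + 1)).map (durrmeyerEigenvalue d N) with hl
  have hfin : (massMatrix d N).finite_spectrum.toFinset = l.toFinset := by
    ext μ
    rw [Set.Finite.mem_toFinset, spectrum_massMatrix hd hL]
    simp [hl]
  have hpair : l.Pairwise (· > ·) := by
    rw [hl, List.pairwise_map]
    refine List.pairwise_lt_range.imp_of_mem fun {a b} _ hb hab => ?_
    exact durrmeyerEigenvalue_lt d hab (Nat.le_of_lt_succ (List.mem_range.mp hb))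
  have hsort : l.toFinset.sort (· ≥ ·) = l :=
    (List.toFinset_sort _ (hpair.imp fun h => h.ne')).mpr (hpair.imp fun h => h.le)
  rw [massEigenvalue, hfin, hsort, hl]
  -- Since k ≤ N is within the list, the default value 0 is not used.
  simp [List.getD_eq_getElem?_getD, Nat.lt_succ_of_le hk]

end

end BernsteinSimplex

theorem mainTheorem5 (d : ℕ) (hd : 1 ≤ d) (N i : ℕ) (hi : i ≤ N)
    (L : (Fin d → ℕ) → MvPolynomial (Fin d) ℝ) (hL : BernsteinSimplex.IsModalBasis d L) :
    ((∀ n : ℕ, (spectrum ℝ (BernsteinSimplex.massMatrix d n)).ncard = n + 1 ∧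
        ∀ μ ∈ spectrum ℝ (BernsteinSimplex.massMatrix d n), 0 < μ) ∧
      hL.transformInv N *
          (BernsteinSimplex.elevation d (Nat.sub_le N i) *
            (BernsteinSimplex.elevation d (Nat.sub_le N i))ᵀ) *
          hL.transform N =
        Matrix.diagonal (fun γ : BernsteinSimplex.ModalIndex d N =>
          if N - i < ∑ j, γ.1 j then 0
          else BernsteinSimplex.massEigenvalue d (N - i) (∑ j, γ.1 j) /
            BernsteinSimplex.massEigenvalue d N (∑ j, γ.1 j))) := by
  refine ⟨fun n => ⟨?_, fun μ hμ => ?_⟩, ?_⟩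
  · rw [BernsteinSimplex.spectrum_massMatrix hd hL, Set.ncard_coe_finset,
      Finset.card_image_of_injOn (BernsteinSimplex.durrmeyerEigenvalue_injOn d n),
      Finset.card_range]
  · rw [BernsteinSimplex.spectrum_massMatrix hd hL, Finset.mem_coe, Finset.mem_image] at hμ
    obtain ⟨k, hk, rfl⟩ := hμ
    exact BernsteinSimplex.durrmeyerEigenvalue_pos d (Finset.mem_range_succ_iff.mp hk)
  · rw [hL.transformInv_elevation_transform]
    congr 1
    funext γ
    split_ifs with h
    · rfl
    -- Here |γ| ≤ N - i, so numerator and denominator both refer to genuine eigenvalues.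
    · rw [BernsteinSimplex.massEigenvalue_eq hd hL (not_lt.mp h),
        BernsteinSimplex.massEigenvalue_eq hd hL γ.2]
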